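/- **Setting.** Let $n,m,t\ge 0$ be integers. A *Pauli string* on a finite register of qubits is a tensor product of the matrices $I,X,Y,Z$ considered modulo phases, and a *stabilizer group* (modulo phases) is a subgroup of the group of Pauli strings that is maximal among the subgroups whose operators commute pairwise. A *stabilizer state* is a unit vector that is a common eigenvector of a stabilizer group $\mathcal Z$ (then $\mathcal Z$ is determined by the state), and a *stabilizer basis* is an orthonormal basis of common eigenvectors of a stabilizer group. A *Clifford operator* is a unitary that maps Pauli operators to Pauli operators under conjugation. Consider $n$ data qubits and $m$ ancillas initialised in a stabilizer state $|\psi\rangle$. A *$t$-doped circuit* on the $n+m$ qubits is a unitary $U=C_0\prod_{k=1}^t T_{q_k}C_k$, where $C_0,\dots,C_t$ are Clifford operators and $T_{q_k}$ is the gate $T=\mathrm{diag}(1,e^{i\pi/4})$ on qubit $q_k$. Let $\{|\Phi'_b\rangle\}_b$ be a stabilizer basis on the $n+m$ qubits with stabilizer group $\mathcal S'$. The corresponding *$t$-doped POVM* is the $n$-qubit POVM $$\mu_b=(I\otimes\langle\psi|)\,U^\dagger|\Phi'_b\rangle\langle\Phi'_b|U\,(I\otimes|\psi\rangle),\qquad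 b\in\{0,1\}^{n+m},$$ and $s_{\boldsymbol\mu}=\dim\operatorname{span}\{\mu_b\}_b$. *Gadget picture.* Add $t$ gadget qubits and replace the $k$-th $T$ gate by a CNOT with control $q_k$ and target the $k$-th gadget qubit, which gives the Clifford operator $\tilde U=C_0\prod_{k=1}^t\mathrm{CNOT}_k\,C_k$ on $n+m+t$ qubits. Let $\tilde{\mathcal S}=\tilde U^\dagger(\mathcal S'\otimes\langle Z_1,\dots,Z_t\rangle)\tilde U$ (modulo phases) be the Heisenberg-evolved stabilizer group of the measurement, with the gadget qubits measured in the computational basis. Projecting the ancillas onto $|\psi\rangle$ leaves the group of Pauli strings on the $n$ data and $t$ gadget qubits $$\mathcal S=\{\pi_{n+t}(g):\ g\in\tilde{\mathcal S},\ \pi_m(g)\in\mathcal Z\},$$ where $\mathcal Z$ is the stabilizer group of $|\psi\rangle$ modulo phases, and $\pi_{n+t},\pi_m$ restrict a Pauli string to the data and gadget qubits, and to the ancillas, respectively. Let $\mathcal S_n,\mathcal S_t\le\mathcal S$ be the subgroups of elements acting nontrivially only on the data qubits, respectively only on the gadget qubits. With $\dim$ the number of independent generators, the entanglement $p$ of the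 stabilizer states of $\mathcal S$ is given by $2p=n+t-\dim\mathcal S_n-\dim\mathcal S_t$, and these states are *maximally entangled* if $p=\min(n,t)$. **Theorem.** Suppose that $t\le n$ and $t\le m$. For every $t$-doped POVM as above such that the stabilizer states of $\mathcal S$ are maximally entangled, $$s_{\boldsymbol\mu}\le 2^n\left(\tfrac32\right)^t .$$ -/

import Mathlib

open scoped Matrix

noncomputable section

/-- Operators on the Hilbert space of a register of qubits labelled by `ι`, in the computational
basis `ι → Fin 2`. -/
abbrev QOp (ι : Type) : Type := Matrix (ι → Fin 2) (ι → Fin 2) ℂ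

/-- State vectors of a register of qubits labelled by `ι`. -/
abbrev QState (ι : Type) : Type := EuclideanSpace ℂ (ι → Fin 2)

/-- Pauli strings, i.e. Pauli operators modulo phases. The pair at qubit `i` is `(x, z)`, with
`(0,0), (1,0), (1,1), (0,1)` standing for `I, X, Y, Z`; the product of Pauli strings becomes the
addition. -/
abbrev PauliString (ι : Type) : Type := ι → ZMod 2 × ZMod 2

/-- The single-qubit Pauli matrices. -/
def pauliMatrix (p : ZMod 2 × ZMod 2) : Matrix (Fin 2) (Fin 2) ℂ :=
  if p = (0, 0) then 1
  else if p = (1, 0) then !![0, 1; 1, 0]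
  else if p = (1, 1) then !![0, -Complex.I; Complex.I, 0]
  else !![1, 0; 0, -1]

/-- The natural lift of a Pauli string to a Pauli operator: the tensor product of the Pauli
matrices at the individual qubits. -/
def pauliOp {ι : Type} [Fintype ι] (P : PauliString ι) : QOp ι :=
  Matrix.of fun x y => ∏ i, pauliMatrix (P i) (x i) (y i)

/-- Clifford operators: unitaries that map Pauli operators to Pauli operators (with phases in
`{±1, ±i}`) under conjugation. -/
def IsClifford {ι : Type} [Fintype ι] [DecidableEq ι] (U : QOp ι) : Prop :=
  U ∈ Matrix.unitaryGroup (ι → Fin 2) ℂ ∧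
    ∀ P : PauliString ι, ∃ (Q : PauliString ι) (k : ℕ),
      U * pauliOp P * Uᴴ = Complex.I ^ k • pauliOp Q

/-- Stabilizer groups modulo phases: sets of Pauli strings closed under multiplication that are
maximal among those whose operators commute pairwise. -/
def IsStabilizerGroup {ι : Type} [Fintype ι] [DecidableEq ι]
    (S : Submodule (ZMod 2) (PauliString ι)) : Prop :=
  Maximal (fun S' : Submodule (ZMod 2) (PauliString ι) =>
    ∀ P ∈ S', ∀ Q ∈ S', Commute (pauliOp P) (pauliOp Q)) S

/-- `ψ` is stabilised by `P` up to a sign. -/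
def StabilizedUpToSign {ι : Type} [Fintype ι] [DecidableEq ι]
    (P : PauliString ι) (ψ : QState ι) : Prop :=
  pauliOp P *ᵥ ψ.ofLp = ψ.ofLp ∨ pauliOp P *ᵥ ψ.ofLp = -ψ.ofLp

/-- Stabilizer states. -/
def IsStabilizerState {ι : Type} [Fintype ι] [DecidableEq ι] (ψ : QState ι) : Prop :=
  ‖ψ‖ = 1 ∧ ∃ Z : Submodule (ZMod 2) (PauliString ι),
    IsStabilizerGroup Z ∧ ∀ P ∈ Z, StabilizedUpToSign P ψ

/-- The stabilizer group (modulo phases) of a state. -/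
def stabilizerOf {ι : Type} [Fintype ι] [DecidableEq ι] (ψ : QState ι) :
    Submodule (ZMod 2) (PauliString ι) :=
  Submodule.span (ZMod 2) {P | StabilizedUpToSign P ψ}

/-- `Φ` is the stabilizer basis associated with the stabilizer group `S`: an orthonormal basis of
common eigenvectors of `S`. -/
def IsStabilizerBasis {ι : Type} [Fintype ι] [DecidableEq ι]
    (S : Submodule (ZMod 2) (PauliString ι))
    (Φ : OrthonormalBasis (ι → Fin 2) ℂ (QState ι)) : Prop :=
  IsStabilizerGroup S ∧ ∀ b, ∀ P ∈ S, StabilizedUpToSign P (Φ b)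

/-- The `T` gate `diag(1, e^{iπ/4})` acting on the qubit `q`. -/
def tGate {ι : Type} [Fintype ι] [DecidableEq ι] (q : ι) : QOp ι :=
  Matrix.diagonal fun x => if x q = 1 then Complex.exp (Real.pi / 4 * Complex.I) else 1

/-- The controlled-NOT gate with control `c` and target `d`. -/
def cnotGate {ι : Type} [Fintype ι] [DecidableEq ι] (c d : ι) : QOp ι :=
  Matrix.of fun x y => if x = Function.update y d (y d + y c) then 1 else 0

/-- The operator `A ⊗ I`, acting as `A` on the qubits `ι` and trivially on the qubits `κ`. -/
def extendOp {ι κ : Type} [Fintype κ] [DecidableEq κ] (A : QOp ι) : QOp (ι ⊕ κ) :=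
  Matrix.of fun x y => A (x ∘ Sum.inl) (y ∘ Sum.inl) *
    (if x ∘ Sum.inr = y ∘ Sum.inr then 1 else 0)

/-- A circuit made of Clifford operators `C₀, …, C_t` and `t` `T` gates between them, the `k`-th
one acting on the qubit `site k`. -/
structure DopedCircuit (ι : Type) [Fintype ι] [DecidableEq ι] (t : ℕ) where
  clifford : Fin (t + 1) → QOp ι
  site : Fin t → ι
  isClifford : ∀ k, IsClifford (clifford k)

/-- The unitary `C₀ (T C₁) (T C₂) ⋯ (T C_t)` implemented by a `t`-doped circuit. -/
def DopedCircuit.unitary {ι : Type} [Fintype ι] [DecidableEq ι] {t : ℕ}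
    (C : DopedCircuit ι t) : QOp ι :=
  C.clifford 0 * (List.ofFn fun k : Fin t => tGate (C.site k) * C.clifford k.succ).prod

/-- The Clifford operator `C₀ (CNOT₁ C₁) ⋯ (CNOT_t C_t)` of the gadget picture: there is one
gadget qubit per `T` gate, and the `k`-th `T` gate is replaced by a CNOT controlled by the qubit on
which it acts and with the `k`-th gadget qubit as its target. -/
def DopedCircuit.gadgetUnitary {ι : Type} [Fintype ι] [DecidableEq ι] {t : ℕ}
    (C : DopedCircuit ι t) : QOp (ι ⊕ Fin t) :=
  extendOp (C.clifford 0) *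
    (List.ofFn fun k : Fin t =>
      cnotGate (Sum.inl (C.site k)) (Sum.inr k) * extendOp (C.clifford k.succ)).prod

/-- The restriction of Pauli strings to a subregister, given by an embedding `f` of its qubits. -/
abbrev restrictTo {κ ι : Type} (f : κ → ι) : PauliString ι →ₗ[ZMod 2] PauliString κ :=
  LinearMap.funLeft (ZMod 2) (ZMod 2 × ZMod 2) f

/-- The group generated by the operators `Z` on the individual qubits, which describes
measurements in the computational basis. -/
def zGroup (κ : Type) : Submodule (ZMod 2) (PauliString κ) where
  carrier := {P | ∀ i, (P i).1 = 0}
  add_mem' := fun {P Q} hP hQ i => by simp [hP i, hQ i]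
  zero_mem' := fun _ => rfl
  smul_mem' := fun c P hP i => by simp [hP i]

/-- The Heisenberg evolution `U† S U` (modulo phases) of a group of Pauli strings. -/
def heisenberg {ι : Type} [Fintype ι] [DecidableEq ι] (U : QOp ι)
    (S : Submodule (ZMod 2) (PauliString ι)) : Submodule (ZMod 2) (PauliString ι) :=
  Submodule.span (ZMod 2)
    {P | ∃ Q ∈ S, ∃ k : ℕ, Uᴴ * pauliOp Q * U = Complex.I ^ k • pauliOp P}

/-- The stabilizer group of the physical measurement in the gadget picture: `S` on the original
qubits, and a computational basis measurement on the gadget qubits. -/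
def gadgetMeasurement {ι : Type} (t : ℕ) (S : Submodule (ZMod 2) (PauliString ι)) :
    Submodule (ZMod 2) (PauliString (ι ⊕ Fin t)) :=
  S.comap (restrictTo Sum.inl) ⊓ (zGroup (Fin t)).comap (restrictTo Sum.inr)

/-- The stabilizer group obtained from `S` by projecting the `m` ancillas onto the stabilizer
state `ψ`: the restrictions to the other `n + t` qubits of those elements of `S` whose ancilla part
belongs, up to phases, to the stabilizer group of `ψ`. -/
def projectAncillas {n m t : ℕ} (ψ : QState (Fin m))
    (S : Submodule (ZMod 2) (PauliString ((Fin n ⊕ Fin m) ⊕ Fin t))) :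
    Submodule (ZMod 2) (PauliString (Fin n ⊕ Fin t)) :=
  (S ⊓ (stabilizerOf ψ).comap (restrictTo (Sum.inl ∘ Sum.inr))).map
    (restrictTo (Sum.map Sum.inl id))

/-- The stabilizer group on the `n` data qubits and `t` gadget qubits that describes the
measurement performed by a `t`-doped circuit in the gadget picture: Heisenberg evolution of the
physical measurement through the gadget circuit, then projection of the ancillas. -/
def gadgetStabilizerGroup {n m t : ℕ} (C : DopedCircuit (Fin n ⊕ Fin m) t)
    (ψ : QState (Fin m)) (S : Submodule (ZMod 2) (PauliString (Fin n ⊕ Fin m))) :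
    Submodule (ZMod 2) (PauliString (Fin n ⊕ Fin t)) :=
  projectAncillas ψ (heisenberg C.gadgetUnitary (gadgetMeasurement t S))

/-- The elements of `S` that act nontrivially only on the first subregister. -/
def localLeft {ι κ : Type} (S : Submodule (ZMod 2) (PauliString (ι ⊕ κ))) :
    Submodule (ZMod 2) (PauliString (ι ⊕ κ)) :=
  S ⊓ LinearMap.ker (restrictTo Sum.inr)

/-- The elements of `S` that act nontrivially only on the second subregister. -/
def localRight {ι κ : Type} (S : Submodule (ZMod 2) (PauliString (ι ⊕ κ))) :
    Submodule (ZMod 2) (PauliString (ι ⊕ κ)) :=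
  S ⊓ LinearMap.ker (restrictTo Sum.inl)

/-- The entanglement `p` of the stabilizer states of `S` between two subregisters of `n` and `t`
qubits: `2 p = n + t - dim S_n - dim S_t`. -/
def stabEntanglement {n t : ℕ} (S : Submodule (ZMod 2) (PauliString (Fin n ⊕ Fin t))) : ℚ :=
  ((n : ℚ) + t - Module.finrank (ZMod 2) (localLeft S)
    - Module.finrank (ZMod 2) (localRight S)) / 2

/-- The stabilizer states of `S` are maximally entangled: `p = min(n, t)`. -/
def IsMaximallyEntangled {n t : ℕ}
    (S : Submodule (ZMod 2) (PauliString (Fin n ⊕ Fin t))) : Prop :=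
  stabEntanglement S = (min n t : ℕ)

/-- The isometry `I ⊗ |ψ⟩` that appends ancillas `κ` in the state `ψ`. -/
def appendState {ι κ : Type} [Fintype ι] [DecidableEq ι] (ψ : QState κ) :
    Matrix (ι ⊕ κ → Fin 2) (ι → Fin 2) ℂ :=
  Matrix.of fun x a => if x ∘ Sum.inl = a then ψ (x ∘ Sum.inr) else 0

/-- The effective POVM `μ_b = (I ⊗ ⟨ψ|) U† |Φ_b⟩⟨Φ_b| U (I ⊗ |ψ⟩)` on the qubits `ι`. -/
def effectivePOVM {ι κ : Type} [Fintype ι] [DecidableEq ι] [Fintype κ] [DecidableEq κ]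
    (U : QOp (ι ⊕ κ)) (ψ : QState κ)
    (Φ : OrthonormalBasis (ι ⊕ κ → Fin 2) ℂ (QState (ι ⊕ κ))) (b : ι ⊕ κ → Fin 2) : QOp ι :=
  (appendState (ι := ι) ψ)ᴴ * (Uᴴ * Matrix.vecMulVec (Φ b).ofLp (star (Φ b).ofLp) * U) *
    appendState (ι := ι) ψ

/-- `s_μ`, the dimension of the linear span of the elements of a POVM. -/
def povmSpanDim {ι β : Type} (μ : β → QOp ι) : ℕ :=
  Module.finrank ℂ (Submodule.span ℂ (Set.range μ))

end

/-!
Feeding the magic states `|0⟩ + e^{iπ/4}|1⟩` into the gadget qubits and projecting these onto `|0⟩`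
turns each CNOT of the gadget circuit into a `T` gate, so `U = (I ⊗ ⟨0|) Ũ (I ⊗ |τ⟩)` with `|τ⟩` the
product of the magic states. Since `|0⟩⟨0|` is a combination of strings of `I` and `Z`, every
`U† |Φ_b⟩⟨Φ_b| U` is the expectation over `|τ⟩` of a combination of elements of the evolved
stabilizer group. An element that does not restrict to `𝒮` is removed by the projection onto `|ψ⟩`,
and one with a factor `Z` on some gadget qubit by the projection onto `|τ⟩`, because `Z` has
expectation zero in the magic state. Hence the gadget parts of the surviving elements of `𝒮` take at
most `3 ^ t` values; each is shared by at most `2 ^ dim 𝒮_n` elements, and maximal entanglement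
gives `dim 𝒮_n ≤ n - t`.
-/

/-- The tensor product of the single-qubit operators `A i`, which extends `pauliOp` to factors that
are not Pauli matrices. -/
def tensorOp {ι : Type} [Fintype ι] (A : ι → Matrix (Fin 2) (Fin 2) ℂ) : QOp ι :=
  Matrix.of fun x y => ∏ i, A i (x i) (y i)

section TensorOp

variable {ι : Type} [Fintype ι]

theorem pauliOp_eq_tensorOp (P : PauliString ι) :
    pauliOp P = tensorOp fun i => pauliMatrix (P i) := rfl

theorem tensorOp_smul (c : ι → ℂ) (A : ι → Matrix (Fin 2) (Fin 2) ℂ) :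
    (tensorOp fun i => c i • A i) = (∏ i, c i) • tensorOp A := by
  ext x y
  simp [tensorOp, Finset.prod_mul_distrib]

theorem tensorOp_one : (tensorOp fun _ : ι => (1 : Matrix (Fin 2) (Fin 2) ℂ)) = 1 := by
  ext x y
  simp [tensorOp, Matrix.one_apply, Finset.prod_ite_zero, funext_iff]

theorem conjTranspose_tensorOp (A : ι → Matrix (Fin 2) (Fin 2) ℂ) :
    (tensorOp A)ᴴ = tensorOp fun i => (A i)ᴴ := by
  ext x y
  simp [tensorOp]

variable [DecidableEq ι]

theorem tensorOp_mul (A B : ι → Matrix (Fin 2) (Fin 2) ℂ) :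
    tensorOp A * tensorOp B = tensorOp fun i => A i * B i := by
  ext x y
  simp only [tensorOp, Matrix.mul_apply, Matrix.of_apply, ← Finset.prod_mul_distrib,
    Fintype.prod_sum]

theorem trace_tensorOp (A : ι → Matrix (Fin 2) (Fin 2) ℂ) :
    (tensorOp A).trace = ∏ i, (A i).trace := by
  simp only [tensorOp, Matrix.trace, Matrix.diag_apply, Matrix.of_apply, Fintype.prod_sum]

end TensorOp

section PauliMatrix

theorem pauli_cases (p : ZMod 2 × ZMod 2) :
    p = (0, 0) ∨ p = (1, 0) ∨ p = (1, 1) ∨ p = (0, 1) := by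
  revert p; decide

@[simp] theorem pauliMatrix_I : pauliMatrix (0, 0) = 1 := rfl

@[simp] theorem pauliMatrix_X : pauliMatrix (1, 0) = !![0, 1; 1, 0] := rfl

@[simp] theorem pauliMatrix_Y : pauliMatrix (1, 1) = !![0, -Complex.I; Complex.I, 0] := rfl

@[simp] theorem pauliMatrix_Z : pauliMatrix (0, 1) = !![1, 0; 0, -1] := rfl

theorem conjTranspose_pauliMatrix (p : ZMod 2 × ZMod 2) : (pauliMatrix p)ᴴ = pauliMatrix p := by
  rcases pauli_cases p with rfl | rfl | rfl | rfl <;>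
    ext i j <;> fin_cases i <;> fin_cases j <;> simp

theorem pauliMatrix_mul_self (p : ZMod 2 × ZMod 2) : pauliMatrix p * pauliMatrix p = 1 := by
  rcases pauli_cases p with rfl | rfl | rfl | rfl <;>
    ext i j <;> fin_cases i <;> fin_cases j <;> simp

theorem exists_pauliMatrix_mul_eq_smul (p q : ZMod 2 × ZMod 2) :
    ∃ k : ℕ, pauliMatrix p * pauliMatrix q = Complex.I ^ k • pauliMatrix (p + q) := by
  rcases pauli_cases p with rfl | rfl | rfl | rfl <;>
    rcases pauli_cases q with rfl | rfl | rfl | rfl <;>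
    first
    | (refine ⟨0, ?_⟩
       ext i j
       fin_cases i <;> fin_cases j <;> simp [CharTwo.add_self_eq_zero]; done)
    | (refine ⟨1, ?_⟩
       ext i j
       fin_cases i <;> fin_cases j <;> simp [CharTwo.add_self_eq_zero]; done)
    | (refine ⟨3, ?_⟩
       ext i j
       fin_cases i <;> fin_cases j <;> simp [CharTwo.add_self_eq_zero])

theorem trace_pauliMatrix_mul_of_ne {p q : ZMod 2 × ZMod 2} (h : p ≠ q) :
    (pauliMatrix p * pauliMatrix q).trace = 0 := by
  rcases pauli_cases p with rfl | rfl | rfl | rfl <;>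
    rcases pauli_cases q with rfl | rfl | rfl | rfl <;>
    first
    | exact absurd rfl h
    | simp [Matrix.trace_fin_two]

theorem sum_pauliMatrix_mul (a b c d : Fin 2) :
    ∑ p : ZMod 2 × ZMod 2, pauliMatrix p a b * pauliMatrix p c d =
      2 * ((1 : Matrix (Fin 2) (Fin 2) ℂ) a d * (1 : Matrix (Fin 2) (Fin 2) ℂ) b c) := by
  have sum_zmod_two (f : ZMod 2 → ℂ) : ∑ x, f x = f 0 + f 1 := Fin.sum_univ_two f
  simp only [Fintype.sum_prod_type, sum_zmod_two, pauliMatrix_I, pauliMatrix_X, pauliMatrix_Y,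
    pauliMatrix_Z]
  fin_cases a <;> fin_cases b <;> fin_cases c <;> fin_cases d <;> norm_num

theorem pauliMatrix_apply_zero_zero {p : ZMod 2 × ZMod 2} (h : p.1 ≠ 0) :
    pauliMatrix p 0 0 = 0 := by
  rcases pauli_cases p with rfl | rfl | rfl | rfl <;> simp_all

/-- The entries of `p ⊗ q` conjugated by a CNOT whose control carries `p` and whose target carries
`q`. -/
theorem exists_pauliMatrix_mul_pauliMatrix_add_eq (p q : ZMod 2 × ZMod 2) :
    ∃ k : ℕ, ∀ x y x' y' : Fin 2,
      pauliMatrix p x y * pauliMatrix q (x' + x) (y' + y) =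
        Complex.I ^ k *
          (pauliMatrix (p.1, p.2 + q.2) x y * pauliMatrix (q.1 + p.1, q.2) x' y') := by
  rcases pauli_cases p with rfl | rfl | rfl | rfl <;>
    rcases pauli_cases q with rfl | rfl | rfl | rfl <;>
    first
    | (refine ⟨0, fun x y x' y' => ?_⟩
       fin_cases x <;> fin_cases y <;> fin_cases x' <;> fin_cases y' <;>
         simp [CharTwo.add_self_eq_zero]; done)
    | (refine ⟨2, fun x y x' y' => ?_⟩
       fin_cases x <;> fin_cases y <;> fin_cases x' <;> fin_cases y' <;>
         simp [CharTwo.add_self_eq_zero])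

end PauliMatrix

section PauliOp

variable {ι : Type} [Fintype ι]

theorem pauliOp_zero : pauliOp (0 : PauliString ι) = 1 := tensorOp_one

theorem conjTranspose_pauliOp (P : PauliString ι) : (pauliOp P)ᴴ = pauliOp P := by
  simp only [pauliOp_eq_tensorOp, conjTranspose_tensorOp, conjTranspose_pauliMatrix]

variable [DecidableEq ι]

theorem pauliOp_mul_self (P : PauliString ι) : pauliOp P * pauliOp P = 1 := by
  simp only [pauliOp_eq_tensorOp, tensorOp_mul, pauliMatrix_mul_self, tensorOp_one]

theorem exists_pauliOp_mul_eq_smul (P Q : PauliString ι) :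
    ∃ k : ℕ, pauliOp P * pauliOp Q = Complex.I ^ k • pauliOp (P + Q) := by
  choose k hk using fun i => exists_pauliMatrix_mul_eq_smul (P i) (Q i)
  refine ⟨∑ i, k i, ?_⟩
  simp only [pauliOp_eq_tensorOp, tensorOp_mul, hk, tensorOp_smul, Finset.prod_pow_eq_pow_sum,
    Pi.add_apply]

theorem exists_pauliOp_add_eq_smul (P Q : PauliString ι) :
    ∃ k : ℕ, pauliOp (P + Q) = (Complex.I ^ k)⁻¹ • (pauliOp P * pauliOp Q) := by
  obtain ⟨k, hk⟩ := exists_pauliOp_mul_eq_smul P Q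
  exact ⟨k, by rw [hk, inv_smul_smul₀ (pow_ne_zero k Complex.I_ne_zero)]⟩

theorem pauliOp_commute_or_anticommute (P Q : PauliString ι) :
    Commute (pauliOp P) (pauliOp Q) ∨ pauliOp P * pauliOp Q = -(pauliOp Q * pauliOp P) := by
  obtain ⟨k, hk⟩ := exists_pauliOp_mul_eq_smul P Q
  have hadj : pauliOp Q * pauliOp P = (-1 : ℂ) ^ k • (pauliOp P * pauliOp Q) :=
    calc pauliOp Q * pauliOp P = (pauliOp P * pauliOp Q)ᴴ := by
          simp only [Matrix.conjTranspose_mul, conjTranspose_pauliOp]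
      _ = (-1 : ℂ) ^ k • (pauliOp P * pauliOp Q) := by
          rw [hk, Matrix.conjTranspose_smul, conjTranspose_pauliOp, smul_smul, ← mul_pow]
          simp
  rcases neg_one_pow_eq_or ℂ k with h | h <;> rw [h] at hadj
  · exact .inl (by simpa [Commute, SemiconjBy] using hadj.symm)
  · exact .inr (by simp [hadj])

theorem trace_pauliOp_mul_of_ne {P Q : PauliString ι} (h : P ≠ Q) :
    (pauliOp P * pauliOp Q).trace = 0 := by
  obtain ⟨i, hi⟩ := Function.ne_iff.mp h
  rw [pauliOp_eq_tensorOp, pauliOp_eq_tensorOp, tensorOp_mul, trace_tensorOp]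
  exact Finset.prod_eq_zero (Finset.mem_univ i) (trace_pauliMatrix_mul_of_ne hi)

theorem sum_pauliOp_mul (a b c d : ι → Fin 2) :
    ∑ P : PauliString ι, pauliOp P a b * pauliOp P c d =
      2 ^ Fintype.card ι * ((1 : QOp ι) a d * (1 : QOp ι) b c) := by
  simp only [pauliOp, Matrix.of_apply, ← Finset.prod_mul_distrib]
  rw [← Fintype.prod_sum fun i p => pauliMatrix p (a i) (b i) * pauliMatrix p (c i) (d i)]
  simp only [sum_pauliMatrix_mul, Finset.prod_mul_distrib, Finset.prod_const, Finset.card_univ,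
    ← tensorOp_one, tensorOp, Matrix.of_apply]

theorem sum_trace_smul_pauliOp (M : QOp ι) :
    ∑ P : PauliString ι, (pauliOp P * M).trace • pauliOp P = (2 : ℂ) ^ Fintype.card ι • M := by
  ext c d
  calc (∑ P : PauliString ι, (pauliOp P * M).trace • pauliOp P) c d
      = ∑ P : PauliString ι, ∑ a, ∑ b, M b a * (pauliOp P a b * pauliOp P c d) := by
        simp only [Matrix.sum_apply, Matrix.smul_apply, smul_eq_mul, Matrix.trace,
          Matrix.diag_apply, Matrix.mul_apply, Finset.sum_mul]
        simp only [mul_left_comm, mul_assoc]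
    _ = ∑ a, ∑ b, M b a * ∑ P : PauliString ι, pauliOp P a b * pauliOp P c d := by
        rw [Finset.sum_comm]
        simp only [Finset.sum_comm (s := (Finset.univ : Finset (PauliString ι))), Finset.mul_sum]
    _ = ((2 : ℂ) ^ Fintype.card ι • M) c d := by
        simp [sum_pauliOp_mul, Matrix.one_apply, mul_comm]

theorem mem_span_pauliOp_iff {s : Set (PauliString ι)} {M : QOp ι} :
    M ∈ Submodule.span ℂ (pauliOp '' s) ↔ ∀ P ∉ s, (pauliOp P * M).trace = 0 := by
  refine ⟨fun hM P hP => ?_, fun h => ?_⟩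
  · induction hM using Submodule.span_induction with
    | zero => simp
    | add A B _ _ hA hB => rw [Matrix.mul_add, Matrix.trace_add, hA, hB, add_zero]
    | smul c A _ hA => rw [Matrix.mul_smul, Matrix.trace_smul, hA, smul_zero]
    | mem A hA =>
      obtain ⟨Q, hQ, rfl⟩ := hA
      exact trace_pauliOp_mul_of_ne fun hPQ => hP (hPQ ▸ hQ)
  · rw [← Submodule.smul_mem_iff _ (pow_ne_zero (Fintype.card ι) (two_ne_zero (α := ℂ))),
      ← sum_trace_smul_pauliOp]
    refine Submodule.sum_mem _ fun P _ => ?_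
    by_cases hP : P ∈ s
    · exact Submodule.smul_mem _ _ (Submodule.subset_span ⟨P, hP, rfl⟩)
    · rw [h P hP, zero_smul]
      exact Submodule.zero_mem _

end PauliOp

theorem eq_of_pauliOp_eq_smul {ι : Type} [Fintype ι] {P Q : PauliString ι} {c : ℂ}
    (h : pauliOp P = c • pauliOp Q) :
    P = Q := by
  classical
  by_contra hne
  have htrace : (pauliOp P * pauliOp P).trace = c * (pauliOp P * pauliOp Q).trace := by
    nth_rewrite 2 [h]
    rw [Matrix.mul_smul, Matrix.trace_smul, smul_eq_mul]
  rw [pauliOp_mul_self, trace_pauliOp_mul_of_ne hne, mul_zero, Matrix.trace_one] at htrace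
  simp at htrace

/-- The Pauli strings whose operators commute with those of all strings in `s`. -/
def commutant {ι : Type} [Fintype ι] [DecidableEq ι] (s : Set (PauliString ι)) :
    Submodule (ZMod 2) (PauliString ι) where
  carrier := {P | ∀ Q ∈ s, Commute (pauliOp P) (pauliOp Q)}
  add_mem' {P P'} hP hP' Q hQ := by
    obtain ⟨k, hk⟩ := exists_pauliOp_add_eq_smul P P'
    rw [hk]
    exact ((hP Q hQ).mul_left (hP' Q hQ)).smul_left _
  zero_mem' Q _ := by rw [pauliOp_zero]; exact Commute.one_left _
  smul_mem' c P hP Q hQ := by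
    obtain rfl | rfl : c = 0 ∨ c = 1 := by revert c; decide
    · rw [zero_smul, pauliOp_zero]
      exact Commute.one_left _
    · rw [one_smul]
      exact hP Q hQ

section Commutant

variable {ι : Type} [Fintype ι] [DecidableEq ι]

theorem mem_commutant {s : Set (PauliString ι)} {P : PauliString ι} :
    P ∈ commutant s ↔ ∀ Q ∈ s, Commute (pauliOp P) (pauliOp Q) := Iff.rfl

theorem subset_commutant_comm {s t : Set (PauliString ι)} :
    s ⊆ commutant t ↔ t ⊆ commutant s :=
  ⟨fun h _ hQ _ hP => (h hP _ hQ).symm, fun h _ hQ _ hP => (h hP _ hQ).symm⟩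

theorem span_le_commutant_span {s : Set (PauliString ι)} (h : s ⊆ commutant s) :
    Submodule.span (ZMod 2) s ≤ commutant (Submodule.span (ZMod 2) s : Set (PauliString ι)) :=
  Submodule.span_le.mpr (subset_commutant_comm.mp (Submodule.span_le.mpr h))

theorem IsStabilizerGroup.mem_of_mem_commutant
    {S : Submodule (ZMod 2) (PauliString ι)} (hS : IsStabilizerGroup S) {P : PauliString ι}
    (hP : P ∈ commutant (S : Set (PauliString ι))) : P ∈ S := by
  have hinsert : insert P (S : Set (PauliString ι)) ⊆ commutant (insert P S) :=
    Set.insert_subset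
      (mem_commutant.mpr (Set.forall_mem_insert.mpr ⟨Commute.refl _, hP⟩))
      fun Q hQ => mem_commutant.mpr (Set.forall_mem_insert.mpr ⟨(hP Q hQ).symm, hS.1 Q hQ⟩)
  exact hS.2 (span_le_commutant_span hinsert)
    ((Set.subset_insert P S).trans Submodule.subset_span)
    (Submodule.subset_span (Set.mem_insert P S))

end Commutant

/-- The expectation value `⟨ψ|A|ψ⟩`, without normalisation of `ψ`. -/
noncomputable def expVal {ι : Type} [Fintype ι] [DecidableEq ι] (ψ : QState ι) (A : QOp ι) : ℂ :=
  star ψ.ofLp ⬝ᵥ (A *ᵥ ψ.ofLp)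

section ExpVal

variable {ι : Type} [Fintype ι] [DecidableEq ι]

theorem trace_mul_vecMulVec_star (A : QOp ι) (ψ : QState ι) :
    (A * Matrix.vecMulVec ψ.ofLp (star ψ.ofLp)).trace = expVal ψ A := by
  rw [Matrix.mul_vecMulVec, Matrix.trace_vecMulVec, dotProduct_comm, expVal]

theorem expVal_neg (ψ : QState ι) (A : QOp ι) : expVal ψ (-A) = -expVal ψ A := by
  rw [expVal, Matrix.neg_mulVec, dotProduct_neg, expVal]

theorem StabilizedUpToSign.expVal_mul_mul {Q : PauliString ι} {ψ : QState ι}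
    (hQ : StabilizedUpToSign Q ψ) (A : QOp ι) :
    expVal ψ (pauliOp Q * A * pauliOp Q) = expVal ψ A := by
  have hmove : expVal ψ (pauliOp Q * A * pauliOp Q) =
      star (pauliOp Q *ᵥ ψ.ofLp) ⬝ᵥ (A *ᵥ (pauliOp Q *ᵥ ψ.ofLp)) := by
    rw [Matrix.star_mulVec, conjTranspose_pauliOp, ← Matrix.dotProduct_mulVec,
      Matrix.mulVec_mulVec, Matrix.mulVec_mulVec, expVal, mul_assoc]
  rw [hmove]
  rcases hQ with h | h <;> simp [h, expVal, Matrix.mulVec_neg]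

theorem IsStabilizerGroup.expVal_pauliOp_eq_zero {S : Submodule (ZMod 2) (PauliString ι)}
    (hS : IsStabilizerGroup S) {ψ : QState ι} (hψ : ∀ Q ∈ S, StabilizedUpToSign Q ψ)
    {P : PauliString ι} (hP : P ∉ S) : expVal ψ (pauliOp P) = 0 := by
  obtain ⟨Q, hQ, hPQ⟩ : ∃ Q ∈ S, ¬ Commute (pauliOp P) (pauliOp Q) := by
    by_contra! h
    exact hP (hS.mem_of_mem_commutant h)
  have hanti : pauliOp Q * pauliOp P * pauliOp Q = -pauliOp P := by
    rw [mul_assoc, (pauliOp_commute_or_anticommute P Q).resolve_left hPQ, mul_neg, ← mul_assoc,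
      pauliOp_mul_self, one_mul]
  refine self_eq_neg.mp ?_
  rw [← expVal_neg, ← hanti, (hψ Q hQ).expVal_mul_mul]

theorem IsStabilizerGroup.vecMulVec_star_mem_span_pauliOp {S : Submodule (ZMod 2) (PauliString ι)}
    (hS : IsStabilizerGroup S) {ψ : QState ι} (hψ : ∀ Q ∈ S, StabilizedUpToSign Q ψ) :
    Matrix.vecMulVec ψ.ofLp (star ψ.ofLp) ∈
      Submodule.span ℂ (pauliOp '' (S : Set (PauliString ι))) :=
  mem_span_pauliOp_iff.mpr fun P hP => by
    rw [trace_mul_vecMulVec_star, hS.expVal_pauliOp_eq_zero hψ hP]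

end ExpVal

/-- The unnormalised product state with the single-qubit states `u i`. -/
noncomputable def productState {ι : Type} [Fintype ι] (u : ι → Fin 2 → ℂ) : QState ι :=
  WithLp.toLp 2 fun y => ∏ i, u i (y i)

/-- The input `⊗ₖ (|0⟩ + e^{iπ/4}|1⟩)` of the gadget qubits, not normalised: injecting it through
CNOTs implements `T` gates. -/
noncomputable def magicState (κ : Type) [Fintype κ] : QState κ :=
  productState fun _ x => if x = 1 then Complex.exp (Real.pi / 4 * Complex.I) else 1

section ProductState

variable {κ : Type} [Fintype κ]

theorem magicState_zero : magicState κ 0 = 1 := by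
  simp [magicState, productState]

variable [DecidableEq κ]

theorem expVal_productState_tensorOp (u : κ → Fin 2 → ℂ) (A : κ → Matrix (Fin 2) (Fin 2) ℂ) :
    expVal (productState u) (tensorOp A) = ∏ k, star (u k) ⬝ᵥ (A k *ᵥ u k) := by
  simp only [expVal, productState, tensorOp, dotProduct, Matrix.mulVec, Matrix.of_apply,
    Pi.star_apply, star_prod, Finset.prod_mul_distrib, Fintype.prod_sum]

theorem expVal_magicState_eq_zero {P : PauliString κ} {k : κ} (hk : P k = (0, 1)) :
    expVal (magicState κ) (pauliOp P) = 0 := by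
  rw [magicState, pauliOp_eq_tensorOp, expVal_productState_tensorOp]
  refine Finset.prod_eq_zero (Finset.mem_univ k) ?_
  have hphase : (starRingEnd ℂ) (Complex.exp (Real.pi / 4 * Complex.I)) *
      Complex.exp (Real.pi / 4 * Complex.I) = 1 := by
    rw [Complex.conj_mul']
    exact_mod_cast by simp [Complex.norm_exp]
  simp [hk, pauliMatrix_Z, dotProduct, Matrix.mulVec, Fin.sum_univ_two, hphase]

theorem magicState_update (y : κ → Fin 2) {k : κ} (hk : y k = 0) (a : Fin 2) :
    magicState κ (Function.update y k a) =
      (if a = 1 then Complex.exp (Real.pi / 4 * Complex.I) else 1) * magicState κ y := by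
  simp only [magicState, productState,
    ← Finset.mul_prod_erase Finset.univ _ (Finset.mem_univ k), Function.update_self, hk]
  rw [if_neg zero_ne_one, one_mul]
  congr 1
  refine Finset.prod_congr rfl fun i hi => ?_
  rw [Function.update_of_ne (Finset.ne_of_mem_erase hi)]

theorem expVal_single (y : κ → Fin 2) (A : QOp κ) :
    expVal (EuclideanSpace.single y 1) A = A y y := by
  simp [expVal]

theorem expVal_single_zero_eq_zero {P : PauliString κ} (hP : P ∉ zGroup κ) :
    expVal (EuclideanSpace.single 0 1) (pauliOp P) = 0 := by
  obtain ⟨k, hk⟩ : ∃ k, (P k).1 ≠ 0 := by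
    by_contra! h
    exact hP h
  rw [expVal_single]
  exact Finset.prod_eq_zero (Finset.mem_univ k) (pauliMatrix_apply_zero_zero hk)

end ProductState

section KronOp

open scoped Kronecker

/-- The tensor product `A ⊗ B` of operators on two registers, as an operator on their disjoint
union. -/
def kronOp {ι κ : Type} (A : QOp ι) (B : QOp κ) : QOp (ι ⊕ κ) :=
  (A ⊗ₖ B).submatrix (Equiv.sumArrowEquivProdArrow ι κ (Fin 2))
    (Equiv.sumArrowEquivProdArrow ι κ (Fin 2))

variable {ι κ : Type}

theorem kronOp_apply (A : QOp ι) (B : QOp κ) (x y : ι ⊕ κ → Fin 2) :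
    kronOp A B x y = A (x ∘ Sum.inl) (y ∘ Sum.inl) * B (x ∘ Sum.inr) (y ∘ Sum.inr) := rfl

theorem smul_kronOp (c : ℂ) (A : QOp ι) (B : QOp κ) : kronOp (c • A) B = c • kronOp A B := by
  rw [kronOp, Matrix.smul_kronecker, Matrix.submatrix_smul]
  rfl

theorem conjTranspose_kronOp (A : QOp ι) (B : QOp κ) : (kronOp A B)ᴴ = kronOp Aᴴ Bᴴ := by
  rw [kronOp, Matrix.conjTranspose_submatrix, Matrix.conjTranspose_kronecker, kronOp]

theorem extendOp_eq_kronOp [Fintype κ] [DecidableEq κ] (A : QOp ι) :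
    extendOp (κ := κ) A = kronOp A 1 := rfl

variable [Fintype ι]

theorem appendState_eq_submatrix [DecidableEq ι] (ψ : QState κ) :
    appendState (ι := ι) ψ =
      ((1 : QOp ι) ⊗ₖ Matrix.replicateCol Unit ψ.ofLp).submatrix
        (Equiv.sumArrowEquivProdArrow ι κ (Fin 2)) (Equiv.prodPUnit (ι → Fin 2)).symm := by
  ext x a
  simp [appendState, Matrix.one_apply, Equiv.sumArrowEquivProdArrow, Function.comp_def]

variable [Fintype κ]

theorem pauliOp_eq_kronOp (P : PauliString (ι ⊕ κ)) :
    pauliOp P = kronOp (pauliOp (P ∘ Sum.inl)) (pauliOp (P ∘ Sum.inr)) := by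
  ext x y
  simp [kronOp_apply, pauliOp]

theorem kronOp_one_one : kronOp (1 : QOp ι) (1 : QOp κ) = 1 := by
  rw [kronOp, Matrix.one_kronecker_one, Matrix.submatrix_one_equiv]

variable [DecidableEq ι] [DecidableEq κ]

theorem kronOp_mul_kronOp (A A' : QOp ι) (B B' : QOp κ) :
    kronOp A B * kronOp A' B' = kronOp (A * A') (B * B') := by
  rw [kronOp, kronOp, Matrix.submatrix_mul_equiv, ← Matrix.mul_kronecker_mul, kronOp]

theorem appendState_conj_kronOp (ψ : QState κ) (A : QOp ι) (B : QOp κ) :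
    (appendState (ι := ι) ψ)ᴴ * kronOp A B * appendState (ι := ι) ψ = expVal ψ B • A := by
  rw [appendState_eq_submatrix, kronOp, Matrix.conjTranspose_submatrix,
    Matrix.submatrix_mul_equiv, Matrix.submatrix_mul_equiv, Matrix.conjTranspose_kronecker,
    ← Matrix.mul_kronecker_mul, ← Matrix.mul_kronecker_mul, Matrix.conjTranspose_one, one_mul,
    mul_one, Matrix.mul_assoc, ← Matrix.replicateCol_mulVec, Matrix.conjTranspose_replicateCol]
  ext a b
  simp [Matrix.replicateRow_mul_replicateCol_apply, expVal, mul_comm]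

theorem appendState_conj_pauliOp (ψ : QState κ) (P : PauliString (ι ⊕ κ)) :
    (appendState (ι := ι) ψ)ᴴ * pauliOp P * appendState (ι := ι) ψ =
      expVal ψ (pauliOp (P ∘ Sum.inr)) • pauliOp (P ∘ Sum.inl) := by
  rw [pauliOp_eq_kronOp, appendState_conj_kronOp]

end KronOp

section Clifford

variable {ι : Type} [Fintype ι] [DecidableEq ι]

theorem isClifford_one : IsClifford (1 : QOp ι) :=
  ⟨one_mem _, fun P => ⟨P, 0, by simp⟩⟩

theorem IsClifford.mul {U V : QOp ι} (hU : IsClifford U) (hV : IsClifford V) :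
    IsClifford (U * V) := by
  refine ⟨mul_mem hU.1 hV.1, fun P => ?_⟩
  obtain ⟨Q, k, hQ⟩ := hV.2 P
  obtain ⟨R, l, hR⟩ := hU.2 Q
  refine ⟨R, k + l, ?_⟩
  calc U * V * pauliOp P * (U * V)ᴴ = U * (V * pauliOp P * Vᴴ) * Uᴴ := by
        simp only [Matrix.conjTranspose_mul, mul_assoc]
    _ = Complex.I ^ (k + l) • pauliOp R := by
        rw [hQ, mul_smul_comm, smul_mul_assoc, hR, smul_smul, pow_add]

theorem isClifford_list_prod {L : List (QOp ι)} (hL : ∀ U ∈ L, IsClifford U) :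
    IsClifford L.prod :=
  List.prod_induction _ (fun _ _ => IsClifford.mul) isClifford_one hL

theorem IsClifford.extendOp {κ : Type} [Fintype κ] [DecidableEq κ] {U : QOp ι}
    (hU : IsClifford U) : IsClifford (extendOp (κ := κ) U) := by
  have hUU : U * Uᴴ = 1 := Matrix.mem_unitaryGroup_iff.mp hU.1
  rw [extendOp_eq_kronOp]
  refine ⟨Matrix.mem_unitaryGroup_iff.mpr ?_, fun P => ?_⟩
  · rw [Matrix.star_eq_conjTranspose, conjTranspose_kronOp, kronOp_mul_kronOp, hUU,
      Matrix.conjTranspose_one, one_mul, kronOp_one_one]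
  · obtain ⟨Q, k, hQ⟩ := hU.2 (P ∘ Sum.inl)
    refine ⟨Sum.elim Q (P ∘ Sum.inr), k, ?_⟩
    rw [pauliOp_eq_kronOp P, conjTranspose_kronOp, kronOp_mul_kronOp, kronOp_mul_kronOp, hQ,
      Matrix.conjTranspose_one, one_mul, mul_one, smul_kronOp, pauliOp_eq_kronOp,
      Sum.elim_comp_inl, Sum.elim_comp_inr]

theorem IsClifford.exists_conj_eq_smul {U : QOp ι} (hU : IsClifford U) (Q : PauliString ι) :
    ∃ (P : PauliString ι) (k : ℕ), Uᴴ * pauliOp Q * U = Complex.I ^ k • pauliOp P := by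
  have hUU : Uᴴ * U = 1 := Matrix.mem_unitaryGroup_iff'.mp hU.1
  have unconj (A : QOp ι) : Uᴴ * (U * A * Uᴴ) * U = A := by
    rw [mul_assoc U, ← mul_assoc, hUU, one_mul, mul_assoc, hUU, mul_one]
  choose f k hf using hU.2
  have hconj (P : PauliString ι) :
      Uᴴ * pauliOp (f P) * U = (Complex.I ^ k P)⁻¹ • pauliOp P := by
    rw [eq_inv_smul_iff₀ (pow_ne_zero _ Complex.I_ne_zero), ← unconj (pauliOp P), hf,
      mul_smul_comm, smul_mul_assoc]
  have hinj : Function.Injective f := fun P P' h => by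
    have hsmul := (hconj P).symm.trans (h ▸ hconj P')
    rw [inv_smul_eq_iff₀ (pow_ne_zero _ Complex.I_ne_zero), smul_smul] at hsmul
    exact eq_of_pauliOp_eq_smul hsmul
  obtain ⟨P, rfl⟩ := Finite.surjective_of_injective hinj Q
  refine ⟨P, 3 * k P, ?_⟩
  rw [hconj, pow_mul, Complex.I_pow_three, ← inv_pow, Complex.inv_I]

theorem conj_pauliOp_mem_span_heisenberg {U : QOp ι} (hU : IsClifford U)
    {S : Submodule (ZMod 2) (PauliString ι)} {Q : PauliString ι} (hQ : Q ∈ S) :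
    Uᴴ * pauliOp Q * U ∈
      Submodule.span ℂ (pauliOp '' (heisenberg U S : Set (PauliString ι))) := by
  obtain ⟨P, k, hP⟩ := hU.exists_conj_eq_smul Q
  rw [hP]
  exact Submodule.smul_mem _ _ (Submodule.subset_span
    ⟨P, Submodule.subset_span ⟨Q, hQ, k, hP⟩, rfl⟩)

end Clifford

/-- The permutation of the computational basis implemented by a CNOT gate. -/
def cnotPerm {ι : Type} [DecidableEq ι] {c d : ι} (hcd : c ≠ d) : Equiv.Perm (ι → Fin 2) :=
  Function.Involutive.toPerm (fun x => Function.update x d (x d + x c)) fun x => by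
    have add_self_eq_zero : ∀ a : Fin 2, a + a = 0 := by decide
    simp [hcd, add_assoc, add_self_eq_zero]

section Cnot

variable {ι : Type} [DecidableEq ι] {c d : ι}

theorem cnotPerm_apply (hcd : c ≠ d) (x : ι → Fin 2) :
    cnotPerm hcd x = Function.update x d (x d + x c) := rfl

theorem cnotPerm_inv (hcd : c ≠ d) : (cnotPerm hcd)⁻¹ = cnotPerm hcd := rfl

variable [Fintype ι]

theorem cnotGate_eq_permMatrix (hcd : c ≠ d) :
    cnotGate c d = (cnotPerm hcd).permMatrix ℂ := by
  ext x y
  have hiff : x = cnotPerm hcd y ↔ cnotPerm hcd x = y := by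
    rw [← Equiv.Perm.inv_eq_iff_eq, cnotPerm_inv]
  simp [cnotGate, Equiv.Perm.permMatrix, PEquiv.toMatrix_apply, ← cnotPerm_apply hcd, hiff]

theorem cnotGate_mul_apply {β : Type} (hcd : c ≠ d) (M : Matrix (ι → Fin 2) β ℂ)
    (x : ι → Fin 2) (b : β) :
    (cnotGate c d * M) x b = M (Function.update x d (x d + x c)) b := by
  rw [cnotGate_eq_permMatrix hcd, Equiv.Perm.permMatrix, PEquiv.toMatrix_toPEquiv_mul]
  rfl

theorem cnotGate_conj_apply (hcd : c ≠ d) (A : QOp ι) (x y : ι → Fin 2) :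
    (cnotGate c d * A * (cnotGate c d)ᴴ) x y = A (cnotPerm hcd x) (cnotPerm hcd y) := by
  rw [cnotGate_eq_permMatrix hcd, Matrix.conjTranspose_permMatrix, cnotPerm_inv,
    Equiv.Perm.permMatrix, PEquiv.toMatrix_toPEquiv_mul, PEquiv.mul_toMatrix_toPEquiv]
  rfl

theorem isClifford_cnotGate (hcd : c ≠ d) : IsClifford (cnotGate c d) := by
  refine ⟨Matrix.mem_unitaryGroup_iff.mpr ?_, fun P => ?_⟩
  · rw [Matrix.star_eq_conjTranspose, cnotGate_eq_permMatrix hcd, Matrix.conjTranspose_permMatrix,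
      ← Matrix.permMatrix_mul, inv_mul_cancel, Matrix.permMatrix_one]
  · obtain ⟨k, hk⟩ := exists_pauliMatrix_mul_pauliMatrix_add_eq (P c) (P d)
    refine ⟨Function.update (Function.update P c ((P c).1, (P c).2 + (P d).2)) d
      ((P d).1 + (P c).1, (P d).2), k, ?_⟩
    have prod_split (f : ι → ℂ) : ∏ i, f i = f c * f d * ∏ i ∈ Finset.univ \ {c, d}, f i := by
      rw [← Finset.prod_pair hcd, mul_comm, Finset.prod_sdiff (Finset.subset_univ _)]
    ext x y
    rw [cnotGate_conj_apply hcd, Matrix.smul_apply, smul_eq_mul]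
    simp only [pauliOp, Matrix.of_apply, prod_split, cnotPerm_apply, Function.update_self,
      Function.update_of_ne hcd, hk]
    rw [mul_assoc]
    congr 2
    refine Finset.prod_congr rfl fun i hi => ?_
    obtain ⟨hic, hid⟩ : i ≠ c ∧ i ≠ d := by simpa using hi
    simp only [Function.update_of_ne hic, Function.update_of_ne hid]

end Cnot

section GadgetIdentity

variable {ι κ : Type}

theorem appendState_elim_apply [Fintype ι] [DecidableEq ι] (ψ : QState κ) (a b : ι → Fin 2)
    (y : κ → Fin 2) :
    appendState ψ (Sum.elim a y) b = (1 : QOp ι) a b * ψ y := by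
  rw [Matrix.one_apply, ite_mul, one_mul, zero_mul]
  rfl

theorem extendOp_elim_apply [Fintype κ] [DecidableEq κ] (A : QOp ι) (a a' : ι → Fin 2)
    (y y' : κ → Fin 2) :
    extendOp A (Sum.elim a y) (Sum.elim a' y') = A a a' * (1 : QOp κ) y y' := rfl

variable [Fintype ι] [DecidableEq ι] [Fintype κ] [DecidableEq κ]

theorem sum_sumElim {M : Type*} [AddCommMonoid M] (f : (ι ⊕ κ → Fin 2) → M) :
    ∑ x, f x = ∑ a, ∑ y, f (Sum.elim a y) := by
  rw [← (Equiv.sumArrowEquivProdArrow ι κ (Fin 2)).symm.sum_comp, Fintype.sum_prod_type]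
  rfl

theorem extendOp_mul_apply {β : Type} (A : QOp ι) (M : Matrix (ι ⊕ κ → Fin 2) β ℂ)
    (a : ι → Fin 2) (y : κ → Fin 2) (b : β) :
    (extendOp (κ := κ) A * M) (Sum.elim a y) b = ∑ a', A a a' * M (Sum.elim a' y) b := by
  rw [Matrix.mul_apply, sum_sumElim]
  simp [extendOp_elim_apply, Matrix.one_apply]

theorem conjTranspose_appendState_single_mul_apply {β : Type} (y : κ → Fin 2)
    (M : Matrix (ι ⊕ κ → Fin 2) β ℂ) (a : ι → Fin 2) (b : β) :
    ((appendState (ι := ι) (EuclideanSpace.single y (1 : ℂ)))ᴴ * M) a b =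
      M (Sum.elim a y) b := by
  rw [Matrix.mul_apply, sum_sumElim]
  simp [appendState_elim_apply, Matrix.one_apply, apply_ite (starRingEnd ℂ), ite_mul]

theorem gadget_prod_apply (q : κ → ι) (c : κ → QOp ι) {L : List κ} (hL : L.Nodup)
    {y : κ → Fin 2} (hy : ∀ k ∈ L, y k = 0) (a b : ι → Fin 2) :
    ((L.map fun k =>
        (cnotGate (Sum.inl (q k)) (Sum.inr k) * extendOp (c k) : QOp (ι ⊕ κ))).prod *
          appendState (ι := ι) (magicState κ)) (Sum.elim a y) b =
      magicState κ y * (L.map fun k => tGate (q k) * c k).prod a b := by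
  induction L generalizing y a with
  | nil => simp [appendState_elim_apply, mul_comm]
  | cons k L ih =>
    obtain ⟨hkL, hL⟩ := List.nodup_cons.mp hL
    obtain ⟨hyk, hyL⟩ := List.forall_mem_cons.mp hy
    have hy' (v : Fin 2) : ∀ l ∈ L, Function.update y k v l = 0 := fun l hl => by
      rw [Function.update_of_ne (ne_of_mem_of_not_mem hl hkL), hyL l hl]
    rw [List.map_cons, List.prod_cons, List.map_cons, List.prod_cons, Matrix.mul_assoc,
      Matrix.mul_assoc, cnotGate_mul_apply Sum.inl_ne_inr, Sum.update_elim_inr,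
      extendOp_mul_apply, tGate, Matrix.mul_assoc, Matrix.diagonal_mul, Matrix.mul_apply]
    simp only [Sum.elim_inl, Sum.elim_inr, hyk, zero_add, ih hL (hy' _),
      magicState_update y hyk, Finset.mul_sum]
    exact Finset.sum_congr rfl fun a' _ => by ring

end GadgetIdentity

namespace DopedCircuit

variable {ι : Type} [Fintype ι] [DecidableEq ι] {t : ℕ}

theorem isClifford_gadgetUnitary (C : DopedCircuit ι t) : IsClifford C.gadgetUnitary := by
  refine (C.isClifford 0).extendOp.mul (isClifford_list_prod ?_)
  simp only [List.forall_mem_ofFn_iff]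
  exact fun k => (isClifford_cnotGate Sum.inl_ne_inr).mul (C.isClifford k.succ).extendOp

theorem unitary_eq_gadget (C : DopedCircuit ι t) :
    C.unitary =
      (appendState (ι := ι) (EuclideanSpace.single (0 : Fin t → Fin 2) (1 : ℂ)))ᴴ *
        C.gadgetUnitary * appendState (ι := ι) (magicState (Fin t)) := by
  ext a b
  rw [Matrix.mul_assoc, conjTranspose_appendState_single_mul_apply, gadgetUnitary,
    Matrix.mul_assoc, extendOp_mul_apply, unitary, Matrix.mul_apply, List.ofFn_eq_map,
    List.ofFn_eq_map]
  simp only [gadget_prod_apply C.site (fun k => C.clifford k.succ) (List.nodup_finRange t)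
    (y := 0) (fun _ _ => rfl), magicState_zero, one_mul]

end DopedCircuit

/-- The elements of `S` with no factor `Z` on the second register; only these survive when that
register is projected onto the magic states. -/
def zFree {ι κ : Type} (S : Submodule (ZMod 2) (PauliString (ι ⊕ κ))) :
    Set (PauliString (ι ⊕ κ)) :=
  {P | P ∈ S ∧ ∀ k, P (Sum.inr k) ≠ (0, 1)}

theorem conjTranspose_mul_mul_mem_of_mem_span {R m n : Type*} [CommSemiring R] [Star R]
    [Fintype m] {V : Matrix m n R} {s : Set (Matrix m m R)} {N : Submodule R (Matrix n n R)}
    (h : ∀ A ∈ s, Vᴴ * A * V ∈ N) {M : Matrix m m R} (hM : M ∈ Submodule.span R s) :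
    Vᴴ * M * V ∈ N := by
  induction hM using Submodule.span_induction with
  | mem A hA => exact h A hA
  | zero => simp
  | add A B _ _ hA hB =>
    rw [Matrix.mul_add, Matrix.add_mul]
    exact add_mem hA hB
  | smul c A _ hA =>
    rw [Matrix.mul_smul, Matrix.smul_mul]
    exact N.smul_mem c hA

section Conjugation

variable {ι : Type} [Fintype ι] [DecidableEq ι]

theorem appendState_single_zero_mul_mem_span {t : ℕ}
    {S : Submodule (ZMod 2) (PauliString ι)} {A : QOp ι}
    (hA : A ∈ Submodule.span ℂ (pauliOp '' (S : Set (PauliString ι)))) :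
    appendState (ι := ι) (EuclideanSpace.single (0 : Fin t → Fin 2) (1 : ℂ)) * A *
        (appendState (ι := ι) (EuclideanSpace.single (0 : Fin t → Fin 2) (1 : ℂ)))ᴴ ∈
      Submodule.span ℂ
        (pauliOp '' (gadgetMeasurement t S : Set (PauliString (ι ⊕ Fin t)))) := by
  refine mem_span_pauliOp_iff.mpr fun P hP => ?_
  rw [← Matrix.mul_assoc, Matrix.trace_mul_comm, ← Matrix.mul_assoc, ← Matrix.mul_assoc,
    appendState_conj_pauliOp, smul_mul_assoc, Matrix.trace_smul]
  by_cases hS : P ∘ Sum.inl ∈ S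
  · have hZ : P ∘ Sum.inr ∉ zGroup (Fin t) := fun hZ => hP ⟨hS, hZ⟩
    rw [expVal_single_zero_eq_zero hZ, zero_smul]
  · rw [mem_span_pauliOp_iff.mp hA _ hS, smul_zero]

theorem appendState_magicState_conj_mem_span {κ : Type} [Fintype κ] [DecidableEq κ]
    {S : Submodule (ZMod 2) (PauliString (ι ⊕ κ))} {P : PauliString (ι ⊕ κ)} (hP : P ∈ S) :
    (appendState (ι := ι) (magicState κ))ᴴ * pauliOp P * appendState (ι := ι) (magicState κ) ∈
      Submodule.span ℂ ((fun P => pauliOp (P ∘ Sum.inl)) '' zFree S) := by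
  rw [appendState_conj_pauliOp]
  by_cases hZ : ∃ k, P (Sum.inr k) = (0, 1)
  · obtain ⟨k, hk⟩ := hZ
    rw [expVal_magicState_eq_zero (k := k) hk, zero_smul]
    exact zero_mem _
  · exact Submodule.smul_mem _ _ (Submodule.subset_span ⟨P, ⟨hP, not_exists.mp hZ⟩, rfl⟩)

theorem DopedCircuit.unitary_conj_mem_span {t : ℕ} (C : DopedCircuit ι t)
    {S : Submodule (ZMod 2) (PauliString ι)} {A : QOp ι}
    (hA : A ∈ Submodule.span ℂ (pauliOp '' (S : Set (PauliString ι)))) :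
    C.unitaryᴴ * A * C.unitary ∈
      Submodule.span ℂ ((fun P => pauliOp (P ∘ Sum.inl)) ''
        zFree (heisenberg C.gadgetUnitary (gadgetMeasurement t S))) := by
  have hgadget := conjTranspose_mul_mul_mem_of_mem_span (V := C.gadgetUnitary)
    (Set.forall_mem_image.mpr fun Q hQ =>
      conj_pauliOp_mem_span_heisenberg C.isClifford_gadgetUnitary hQ)
    (appendState_single_zero_mul_mem_span hA)
  have hdata := conjTranspose_mul_mul_mem_of_mem_span
    (V := appendState (ι := ι) (magicState (Fin t)))
    (Set.forall_mem_image.mpr fun P hP => appendState_magicState_conj_mem_span hP) hgadget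
  simpa only [C.unitary_eq_gadget, Matrix.conjTranspose_mul, Matrix.conjTranspose_conjTranspose,
    Matrix.mul_assoc] using hdata

theorem IsStabilizerState.expVal_pauliOp_eq_zero {ψ : QState ι} (hψ : IsStabilizerState ψ)
    {P : PauliString ι} (hP : P ∉ stabilizerOf ψ) : expVal ψ (pauliOp P) = 0 := by
  obtain ⟨-, Z, hZ, hstab⟩ := hψ
  exact hZ.expVal_pauliOp_eq_zero hstab fun hPZ =>
    hP (Submodule.subset_span (hstab P hPZ))

end Conjugation

theorem effectivePOVM_mem_span {n m t : ℕ} (C : DopedCircuit (Fin n ⊕ Fin m) t)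
    {ψ : QState (Fin m)} (hψ : IsStabilizerState ψ)
    {S : Submodule (ZMod 2) (PauliString (Fin n ⊕ Fin m))}
    {Φ : OrthonormalBasis (Fin n ⊕ Fin m → Fin 2) ℂ (QState (Fin n ⊕ Fin m))}
    (hΦ : IsStabilizerBasis S Φ) (b : Fin n ⊕ Fin m → Fin 2) :
    effectivePOVM C.unitary ψ Φ b ∈
      Submodule.span ℂ ((fun P => pauliOp (P ∘ Sum.inl)) ''
        zFree (gadgetStabilizerGroup C ψ S)) := by
  refine conjTranspose_mul_mul_mem_of_mem_span (Set.forall_mem_image.mpr fun P hP => ?_)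
    (C.unitary_conj_mem_span (hΦ.1.vecMulVec_star_mem_span_pauliOp (hΦ.2 b)))
  rw [appendState_conj_pauliOp]
  by_cases hanc : (P ∘ Sum.inl) ∘ Sum.inr ∈ stabilizerOf ψ
  · refine Submodule.smul_mem _ _ (Submodule.subset_span ⟨P ∘ Sum.map Sum.inl id, ⟨?_, hP.2⟩, rfl⟩)
    exact ⟨P, ⟨hP.1, hanc⟩, rfl⟩
  · rw [hψ.expVal_pauliOp_eq_zero hanc, zero_smul]
    exact zero_mem _

section Counting

theorem ncard_sep_map_mem_le {K V W : Type*} [Ring K] [AddCommGroup V] [AddCommGroup W]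
    [Module K V] [Module K W] [Finite V] [Finite W] (f : V →ₗ[K] W) (S : Submodule K V)
    (T : Set W) :
    {v | v ∈ S ∧ f v ∈ T}.ncard ≤ T.ncard * Nat.card ↥(S ⊓ LinearMap.ker f) := by
  let rep (w : W) : V := Function.invFunOn f S w
  have hrep {v : V} (hv : v ∈ S) : rep (f v) ∈ S ∧ f (rep (f v)) = f v :=
    ⟨Function.invFunOn_mem ⟨v, hv, rfl⟩, Function.invFunOn_eq ⟨v, hv, rfl⟩⟩
  rw [← SetLike.coe_sort_coe, Nat.card_coe_set_eq, ← Set.ncard_prod]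
  refine Set.ncard_le_ncard_of_injOn (fun v => (f v, v - rep (f v))) ?_ ?_
  · rintro v ⟨hv, hT⟩
    refine ⟨hT, S.sub_mem hv (hrep hv).1, ?_⟩
    rw [SetLike.mem_coe, LinearMap.mem_ker, map_sub, (hrep hv).2, sub_self]
  · rintro v - w - h
    have hf : f v = f w := congrArg Prod.fst h
    have hsub : v - rep (f v) = w - rep (f w) := congrArg Prod.snd h
    exact sub_left_injective (hf ▸ hsub)

theorem ncard_forall_ne {κ α : Type*} [Fintype κ] [Fintype α] (a : α) :
    {f : κ → α | ∀ k, f k ≠ a}.ncard = (Fintype.card α - 1) ^ Fintype.card κ := by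
  classical
  have hpi : {f : κ → α | ∀ k, f k ≠ a} = ↑(Fintype.piFinset fun _ : κ => ({a}ᶜ : Finset α)) := by
    ext f
    simp
  rw [hpi, Set.ncard_coe_finset, Fintype.card_piFinset, Finset.prod_const, Finset.card_univ,
    Finset.card_compl, Finset.card_singleton]

theorem ncard_zFree_le {ι κ : Type} [Finite ι] [Fintype κ]
    (S : Submodule (ZMod 2) (PauliString (ι ⊕ κ))) :
    (zFree S).ncard ≤ 2 ^ Module.finrank (ZMod 2) (localLeft S) * 3 ^ Fintype.card κ :=
  calc (zFree S).ncard
      ≤ {P : PauliString κ | ∀ k, P k ≠ (0, 1)}.ncard * Nat.card (localLeft S) :=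
        ncard_sep_map_mem_le (restrictTo Sum.inr) S {P : PauliString κ | ∀ k, P k ≠ (0, 1)}
    _ = 2 ^ Module.finrank (ZMod 2) (localLeft S) * 3 ^ Fintype.card κ := by
        rw [ncard_forall_ne, Module.natCard_eq_pow_finrank (K := ZMod 2), Nat.card_zmod, mul_comm]
        rfl

end Counting

theorem theorem6_general (n m t : ℕ) (C : DopedCircuit (Fin n ⊕ Fin m) t)
    (ψ : QState (Fin m)) (hψ : IsStabilizerState ψ)
    (S : Submodule (ZMod 2) (PauliString (Fin n ⊕ Fin m)))
    (Φ : OrthonormalBasis (Fin n ⊕ Fin m → Fin 2) ℂ (QState (Fin n ⊕ Fin m)))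
    (hΦ : IsStabilizerBasis S Φ) :
    povmSpanDim (effectivePOVM C.unitary ψ Φ) ≤
      2 ^ Module.finrank (ZMod 2) (localLeft (gadgetStabilizerGroup C ψ S)) * 3 ^ t := by
  let G := gadgetStabilizerGroup C ψ S
  let dataOp (P : PauliString (Fin n ⊕ Fin t)) : QOp (Fin n) := pauliOp (P ∘ Sum.inl)
  calc povmSpanDim (effectivePOVM C.unitary ψ Φ)
      ≤ Module.finrank ℂ (Submodule.span ℂ (dataOp '' zFree G)) :=
        Submodule.finrank_mono (Submodule.span_le.mpr
          (Set.range_subset_iff.mpr (effectivePOVM_mem_span C hψ hΦ)))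
    _ ≤ (dataOp '' zFree G).ncard := by
        have := Fintype.ofFinite ↑(dataOp '' zFree G)
        rw [Set.ncard_eq_toFinset_card']
        exact finrank_span_le_card _
    _ ≤ (zFree G).ncard := Set.ncard_image_le
    _ ≤ 2 ^ Module.finrank (ZMod 2) (localLeft G) * 3 ^ t := by
        simpa only [Fintype.card_fin] using ncard_zFree_le G

theorem IsMaximallyEntangled.two_pow_finrank_localLeft_mul_le {n t : ℕ} (htn : t ≤ n)
    {S : Submodule (ZMod 2) (PauliString (Fin n ⊕ Fin t))} (hS : IsMaximallyEntangled S) :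
    (2 : ℝ) ^ Module.finrank (ZMod 2) (localLeft S) * 3 ^ t ≤ 2 ^ n * (3 / 2) ^ t := by
  have hdim : Module.finrank (ZMod 2) (localLeft S) + t ≤ n := by
    rw [IsMaximallyEntangled, stabEntanglement, min_eq_right htn] at hS
    have hright : (0 : ℚ) ≤ Module.finrank (ZMod 2) (localRight S) := Nat.cast_nonneg _
    have hleft : (Module.finrank (ZMod 2) (localLeft S) : ℚ) + t ≤ n := by
      linarith only [hS, hright]
    exact_mod_cast hleft
  rw [div_pow, mul_div_assoc', le_div_iff₀ (by positivity), mul_right_comm, ← pow_add]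
  gcongr
  norm_num

theorem theorem6 (n m t : ℕ) (htn : t ≤ n) (htm : t ≤ m)
    (C : DopedCircuit (Fin n ⊕ Fin m) t)
    (ψ : QState (Fin m)) (hψ : IsStabilizerState ψ)
    (S : Submodule (ZMod 2) (PauliString (Fin n ⊕ Fin m)))
    (Φ : OrthonormalBasis (Fin n ⊕ Fin m → Fin 2) ℂ (QState (Fin n ⊕ Fin m)))
    (hΦ : IsStabilizerBasis S Φ)
    (hmax : IsMaximallyEntangled (gadgetStabilizerGroup C ψ S)) :
    (povmSpanDim (effectivePOVM C.unitary ψ Φ) : ℝ) ≤ 2 ^ n * (3 / 2 : ℝ) ^ t := by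
  have hspan : (povmSpanDim (effectivePOVM C.unitary ψ Φ) : ℝ) ≤
      2 ^ Module.finrank (ZMod 2) (localLeft (gadgetStabilizerGroup C ψ S)) * 3 ^ t :=
    mod_cast theorem6_general n m t C ψ hψ S Φ hΦ
  exact hspan.trans (hmax.two_pow_finrank_localLeft_mul_le htn)
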